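/- There are $n$ balls, $B=\{1,\dots,n\}$, each coloured with one of two colours in a way unknown to us. A ball $b\in A$ is a majority ball of a set $A\subseteq B$ if more than $|A|/2$ balls of $A$ have the colour of $b$, and a non-minority ball of $A$ if at least $|A|/2$ balls of $A$ have the colour of $b$. A (non-adaptive) query set is a family $\mathcal Q\subseteq\binom B3$ of triples of balls; the answer to a query $Q\in\mathcal Q$ is some majority ball of $Q$. A colouring is legal for a sequence of answers if each answer is a majority ball of its query in that colouring. $\mathcal Q$ determines a non-minority ball if for every sequence of answers to all queries of $\mathcal Q$ that is legal for at least one colouring there is a ball that is a non-minority ball of $B$ in every colouring legal for these answers. For distinct balls $x,y$ let the co-degree $d_{\mathcal Q}(x,y)$ be the number of $Q\in\mathcal Q$ with $\{x,y\}\subset Q$, and let $\delta_2(\mathcal Q)$ be the minimum co-degree over all pairs of distinct balls. (i) If $n$ is odd, $\mathcal Q\subseteq\binom B3$, and there is a pair of distinct balls $x,y$ with $d_{\mathcal Q}(x,y)<\frac{n-2}2$, then $\mathcal Q$ does not determine a non-minority ball. (ii) For every $n\ge 5$ there is a query set $\mathcal Q\subseteq\binom B3$ with $\delta_2(\mathcal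 Q)=\lfloor n/2\rfloor+1$ that determines a non-minority ball. (iii) If $n$ is even, $\mathcal Q\subseteq\binom B3$, and there are four distinct balls $x,y,u,v$ with $d_{\mathcal Q}(x,u)+d_{\mathcal Q}(x,v)+d_{\mathcal Q}(y,u)+d_{\mathcal Q}(y,v)\le \frac n2-3$, then $\mathcal Q$ does not determine a non-minority ball. (iv) Every query set $\mathcal Q\subseteq\binom B3$ with $\delta_2(\mathcal Q)>\frac{5n}6$ determines a non-minority ball. (v) For every $n\ge 4$ there is a query set $\mathcal Q\subseteq\binom B3$ with $\delta_2(\mathcal Q)=\lfloor \frac{5n}6\rfloor-3$ (so $\delta_2(\mathcal Q)=\frac{5n}6-3$ when $6\mid n$) that does not determine a non-minority ball. -/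

import Mathlib

/-!
Balls are the elements of `Fin n`. A colouring with two colours is a map `c : Fin n → Bool`.
A non-adaptive set of triple queries is a family `𝒬` of three-element sets of balls.
-/

namespace MajorityBalls

/-- `b` is a majority ball of the set `A`: it lies in `A`, and more than half of the balls of `A`
have the colour of `b`. -/
def IsMajorityBall {n : ℕ} (c : Fin n → Bool) (A : Finset (Fin n)) (b : Fin n) : Prop :=
  b ∈ A ∧ (A.card : ℝ) / 2 < ((A.filter (fun a => c a = c b)).card : ℝ)

/-- `b` is a non-minority ball of the set `A`: it lies in `A`, and at least half of the balls of
`A` have the colour of `b`. -/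
def IsNonMinorityBall {n : ℕ} (c : Fin n → Bool) (A : Finset (Fin n)) (b : Fin n) : Prop :=
  b ∈ A ∧ (A.card : ℝ) / 2 ≤ ((A.filter (fun a => c a = c b)).card : ℝ)

/-- The colouring `c` is legal for the answers `ans` (one ball for each query of `𝒬`): every
answer is a majority ball of its query. -/
def IsLegal {n : ℕ} (𝒬 : Finset (Finset (Fin n))) (ans : {T // T ∈ 𝒬} → Fin n)
    (c : Fin n → Bool) : Prop :=
  ∀ T : {T // T ∈ 𝒬}, IsMajorityBall c T.1 (ans T)

/-- The query set `𝒬` determines a non-minority ball: whatever answers are received (that is, for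
all answers that are possible for at least one colouring), there is a ball that is a non-minority
ball of the set of all balls in every colouring that is legal for these answers. -/
def Determines {n : ℕ} (𝒬 : Finset (Finset (Fin n))) : Prop :=
  ∀ ans : {T // T ∈ 𝒬} → Fin n, (∃ c : Fin n → Bool, IsLegal 𝒬 ans c) →
    ∃ b : Fin n, ∀ c : Fin n → Bool, IsLegal 𝒬 ans c → IsNonMinorityBall c Finset.univ b

/-- The co-degree of two balls: the number of queries that contain both of them. -/
def codegree {n : ℕ} (𝒬 : Finset (Finset (Fin n))) (x y : Fin n) : ℕ :=
  (𝒬.filter (fun T => x ∈ T ∧ y ∈ T)).card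

/-- The minimum co-degree over all pairs of distinct balls (such pairs exist when `2 ≤ n`). -/
noncomputable def minCodegree {n : ℕ} (𝒬 : Finset (Finset (Fin n))) : ℕ :=
  sInf {d : ℕ | ∃ x y : Fin n, x ≠ y ∧ codegree 𝒬 x y = d}

/-- `𝒬` is a set of three-element subsets of the set of balls. -/
def IsTripleQuerySet {n : ℕ} (𝒬 : Finset (Finset (Fin n))) : Prop :=
  𝒬 ⊆ Finset.powersetCard 3 (Finset.univ : Finset (Fin n))

end MajorityBalls

/-!
The answer `t` to a query says only that `t` is not the odd one out of its triple. Say that a family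
of colourings *splits* a triple if each of the three balls is the odd one out in some colouring of
the family. There are answers for which all colourings of the family are legal exactly if no query
is split, so a query set fails to determine a non-minority ball exactly if there is a nonempty
family that splits no query and has each ball in the strict minority in some colouring.

For the negative results three colourings suffice (four if `n = 4` in the last one). If
the co-degrees between two groups `X`, `U` of `k` balls (`k = 1` for odd `n`,
`k = 2` for even `n`) are small, all balls that complete a query
with one ball of each group fit into a set `A` for which the colour classes `A ∪ X ∪ U`, `A ∪ X`,
`A ∪ U` split no query (`not_determines_of_sum_codegree_le`). For co-degrees near `5n / 6`, the balls
are divided into six types of about `n / 6` balls, according to whether they lie in exactly one or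
exactly two of three classes, and `exists_not_determines` starts from all triples that are not split.

For the positive results, suppose that each ball is in the minority in some legal colouring. A
minimal cover of the balls by minority classes has at least three members, each with a private ball
(`IsMinorityCover`). If `p₁`, `p₂` are private to `m₁`, `m₂`, then `{p₁, p₂, z}` is split for
all `z` outside `m₁ ∪ m₂`. Inclusion-exclusion gives two classes with more than `n / 6` such `z`
(`determines_of_lt_minCodegree`). If all missing triples contain a fixed pair, counting the balls
in the classes bounds the co-degree of this pair (`determines_of_sparse_pair`).

In the existence results a minimum co-degree is made exact by adding queries one by one
(`exists_minCodegree_eq`). This keeps the conclusions: determining is inherited by larger query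
sets, and not determining by smaller ones.
-/

/-! ### Majority balls of triples -/

namespace MajorityBalls

open Finset

theorem isMajorityBall_of_eq {n : ℕ} {c : Fin n → Bool} {T : Finset (Fin n)} {a b : Fin n}
    (hT : T.card = 3) (ha : a ∈ T) (hb : b ∈ T) (hab : a ≠ b) (hc : c a = c b) :
    IsMajorityBall c T b := by
  refine ⟨hb, ?_⟩
  have h2 : 2 ≤ (T.filter (fun x => c x = c b)).card := by
    rw [← card_pair hab]
    apply card_le_card
    intro x hx
    rcases mem_insert.1 hx with rfl | hx
    · simp [ha, hc]
    · rw [mem_singleton.1 hx]; simp [hb]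
  have h2' : (2 : ℝ) ≤ ((T.filter (fun x => c x = c b)).card : ℝ) := by exact_mod_cast h2
  rw [hT]
  push_cast
  linarith

theorem IsMajorityBall.exists_eq {n : ℕ} {c : Fin n → Bool} {T : Finset (Fin n)} {b : Fin n}
    (hT : T.card = 3) (h : IsMajorityBall c T b) : ∃ a ∈ T, a ≠ b ∧ c a = c b := by
  obtain ⟨-, h⟩ := h
  have h1 : 1 < (T.filter (fun x => c x = c b)).card := by
    rw [hT] at h
    have : (1 : ℝ) < ((T.filter (fun x => c x = c b)).card : ℝ) := by push_cast at h; linarith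
    exact_mod_cast this
  obtain ⟨a, ha, hab⟩ := exists_mem_ne h1 b
  rw [mem_filter] at ha
  exact ⟨a, ha.1, hab, ha.2⟩

theorem card_of_isTripleQuerySet {n : ℕ} {𝒬 : Finset (Finset (Fin n))}
    (h𝒬 : IsTripleQuerySet 𝒬) {T : Finset (Fin n)} (hT : T ∈ 𝒬) : T.card = 3 :=
  (mem_powersetCard.1 (h𝒬 hT)).2

/-- A criterion for not determining: a family of colourings such that every query contains a ball
that is never the odd one out (so that common answers exist), while every ball is in the strict
minority in some colouring of the family. -/
theorem not_determines_of_colourings {n : ℕ} {ι : Type*} [Nonempty ι]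
    {𝒬 : Finset (Finset (Fin n))} (h𝒬 : IsTripleQuerySet 𝒬) (c : ι → Fin n → Bool)
    (hans : ∀ x y z, x ≠ y → x ≠ z → y ≠ z → {x, y, z} ∈ 𝒬 →
      (∀ i, c i x = c i y ∨ c i x = c i z) ∨ (∀ i, c i y = c i x ∨ c i y = c i z) ∨
        (∀ i, c i z = c i x ∨ c i z = c i y))
    (hmin : ∀ b, ∃ i, 2 * (univ.filter (fun a => c i a = c i b)).card < n) :
    ¬ Determines 𝒬 := by
  intro hdet
  have key : ∀ T : {T // T ∈ 𝒬}, ∃ b, ∀ i, IsMajorityBall (c i) T.1 b := by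
    rintro ⟨T, hT⟩
    have hcard := card_of_isTripleQuerySet h𝒬 hT
    obtain ⟨x, y, z, hxy, hxz, hyz, rfl⟩ := card_eq_three.1 hcard
    have hx : x ∈ ({x, y, z} : Finset (Fin n)) := by simp
    have hy : y ∈ ({x, y, z} : Finset (Fin n)) := by simp
    have hz : z ∈ ({x, y, z} : Finset (Fin n)) := by simp
    rcases hans x y z hxy hxz hyz hT with h | h | h
    · refine ⟨x, fun i => ?_⟩
      rcases h i with h | h
      · exact isMajorityBall_of_eq hcard hy hx hxy.symm h.symm
      · exact isMajorityBall_of_eq hcard hz hx hxz.symm h.symm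
    · refine ⟨y, fun i => ?_⟩
      rcases h i with h | h
      · exact isMajorityBall_of_eq hcard hx hy hxy h.symm
      · exact isMajorityBall_of_eq hcard hz hy hyz.symm h.symm
    · refine ⟨z, fun i => ?_⟩
      rcases h i with h | h
      · exact isMajorityBall_of_eq hcard hx hz hxz h.symm
      · exact isMajorityBall_of_eq hcard hy hz hyz h.symm
  choose ans hlegal using key
  obtain ⟨b, hb⟩ := hdet ans ⟨c (Classical.arbitrary ι), fun T => hlegal T _⟩
  obtain ⟨i, hi⟩ := hmin b
  have h := (hb (c i) fun T => hlegal T i).2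
  rw [card_univ, Fintype.card_fin] at h
  have hi' : (2 : ℝ) * ((univ.filter (fun a => c i a = c i b)).card : ℝ) < n := by
    exact_mod_cast hi
  linarith

/-! ### Co-degrees -/

/-- The balls that complete `x` and `y` to a query. -/
def link {n : ℕ} (𝒬 : Finset (Finset (Fin n))) (x y : Fin n) : Finset (Fin n) :=
  univ.filter (fun z => z ≠ x ∧ z ≠ y ∧ {x, y, z} ∈ 𝒬)

theorem codegree_eq_card_link {n : ℕ} {𝒬 : Finset (Finset (Fin n))} (h𝒬 : IsTripleQuerySet 𝒬)
    {x y : Fin n} (hxy : x ≠ y) : codegree 𝒬 x y = (link 𝒬 x y).card := by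
  symm
  refine card_bij (fun z _ => {x, y, z}) ?_ ?_ ?_
  · intro z hz
    simp only [link, mem_filter, mem_univ, true_and] at hz
    simp [hz.2.2]
  · intro z hz w hw h
    simp only [link, mem_filter, mem_univ, true_and] at hz hw
    have : z ∈ ({x, y, w} : Finset (Fin n)) := by rw [← h]; simp
    simp only [mem_insert, mem_singleton] at this
    tauto
  · intro T hT
    rw [mem_filter] at hT
    obtain ⟨hT, hx, hy⟩ := hT
    have hcard := card_of_isTripleQuerySet h𝒬 hT
    have h1 : ((T.erase x).erase y).card = 1 := by
      rw [card_erase_of_mem (mem_erase.2 ⟨hxy.symm, hy⟩), card_erase_of_mem hx, hcard]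
    obtain ⟨z, hz⟩ := card_eq_one.1 h1
    have hzT : z ≠ y ∧ z ≠ x ∧ z ∈ T := by
      have : z ∈ (T.erase x).erase y := by rw [hz]; simp
      simpa using this
    have hTz : {x, y, z} = T := by
      rw [← insert_erase hx, ← insert_erase (mem_erase.2 ⟨hxy.symm, hy⟩), hz]
    exact ⟨z, by simp [link, hzT, hTz, hT], hTz⟩

theorem codegree_add_card_compl {n : ℕ} {𝒬 : Finset (Finset (Fin n))} (h𝒬 : IsTripleQuerySet 𝒬)
    {x y : Fin n} (hxy : x ≠ y) :
    codegree 𝒬 x y + (univ.filter (fun z => z ≠ x ∧ z ≠ y ∧ {x, y, z} ∉ 𝒬)).card + 2 = n := by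
  have hcard : ((univ.erase x).erase y).card + 2 = n := by
    have hy : y ∈ (univ : Finset (Fin n)).erase x := by simp [hxy.symm]
    have h1 := card_erase_add_one hy
    have h2 := card_erase_add_one (mem_univ x)
    rw [card_univ, Fintype.card_fin] at h2
    omega
  rw [codegree_eq_card_link h𝒬 hxy]
  refine Eq.trans ?_ hcard
  rw [← card_filter_add_card_filter_not (s := (univ.erase x).erase y) (fun z => {x, y, z} ∈ 𝒬)]
  congr 3 <;> · ext z; simp only [link, mem_filter, mem_univ, mem_erase]; tauto

theorem minCodegree_le {n : ℕ} (𝒬 : Finset (Finset (Fin n))) {x y : Fin n} (hxy : x ≠ y) :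
    minCodegree 𝒬 ≤ codegree 𝒬 x y :=
  Nat.sInf_le ⟨x, y, hxy, rfl⟩

theorem exists_codegree_eq_minCodegree {n : ℕ} (hn : 2 ≤ n) (𝒬 : Finset (Finset (Fin n))) :
    ∃ x y : Fin n, x ≠ y ∧ codegree 𝒬 x y = minCodegree 𝒬 :=
  Nat.sInf_mem (s := {d : ℕ | ∃ x y : Fin n, x ≠ y ∧ codegree 𝒬 x y = d})
    ⟨_, ⟨0, by omega⟩, ⟨1, by omega⟩, by simp, rfl⟩

theorem minCodegree_insert_le {n : ℕ} (hn : 2 ≤ n) (𝒬 : Finset (Finset (Fin n)))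
    (T : Finset (Fin n)) : minCodegree (insert T 𝒬) ≤ minCodegree 𝒬 + 1 := by
  obtain ⟨x, y, hxy, h⟩ := exists_codegree_eq_minCodegree hn 𝒬
  refine (minCodegree_le _ hxy).trans ?_
  rw [← h, codegree, codegree, filter_insert]
  split_ifs
  · exact card_insert_le _ _
  · exact Nat.le_succ _

/-- A discrete intermediate value theorem: adding one query raises the minimum co-degree by at
most one. -/
theorem exists_minCodegree_eq {n : ℕ} (hn : 2 ≤ n) {𝒬₀ 𝒬₁ : Finset (Finset (Fin n))}
    (hsub : 𝒬₀ ⊆ 𝒬₁) {t : ℕ} (h₀ : minCodegree 𝒬₀ ≤ t) (h₁ : t ≤ minCodegree 𝒬₁) :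
    ∃ 𝒬, 𝒬₀ ⊆ 𝒬 ∧ 𝒬 ⊆ 𝒬₁ ∧ minCodegree 𝒬 = t := by
  obtain ⟨𝒬, hmem, hmax⟩ := exists_max_image
    ((powerset 𝒬₁).filter (fun 𝒬 => 𝒬₀ ⊆ 𝒬 ∧ minCodegree 𝒬 ≤ t)) card
    ⟨𝒬₀, by simp [hsub, h₀]⟩
  simp only [mem_filter, mem_powerset] at hmem hmax
  obtain ⟨h1, h0, hle⟩ := hmem
  refine ⟨𝒬, h0, h1, le_antisymm hle ?_⟩
  by_contra! hlt
  have hne : ¬ 𝒬₁ ⊆ 𝒬 := fun h => by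
    rw [subset_antisymm h1 h] at hlt
    omega
  obtain ⟨T, hT, hT'⟩ := not_subset.1 hne
  have := hmax (insert T 𝒬) ⟨insert_subset hT h1, h0.trans (subset_insert _ _), by
    have := minCodegree_insert_le hn 𝒬 T
    omega⟩
  rw [card_insert_of_notMem hT'] at this
  omega

/-! ### Small co-degrees between two groups of balls -/

/-- Let `X`, `U` be disjoint groups of `k` balls. If the co-degrees between them sum to at most
`m`, there is a set `A` of `m` further balls that contains all balls outside `X ∪ U` forming a
query with one ball of each group. The three colourings with the classes `A ∪ X ∪ U`, `A ∪ X` and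
`A ∪ U` then have common answers, and the bounds on `m` put each ball in the minority once. -/
theorem not_determines_of_sum_codegree_le {n : ℕ} {𝒬 : Finset (Finset (Fin n))}
    (h𝒬 : IsTripleQuerySet 𝒬) {X U : Finset (Fin n)} (hXU : Disjoint X U) {k m : ℕ}
    (hX : X.card = k) (hU : U.card = k) (hm : ∑ x ∈ X, ∑ u ∈ U, codegree 𝒬 x u ≤ m)
    (hm₁ : 2 * (m + k) < n) (hm₂ : n < 2 * (m + 2 * k)) : ¬ Determines 𝒬 := by
  have hXUc : (X ∪ U).card = 2 * k := by rw [card_union_of_disjoint hXU]; omega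
  have hXUn : (X ∪ U).card ≤ n := by simpa using card_le_univ (X ∪ U)
  have hcompl : (univ \ (X ∪ U)).card = n - 2 * k := by
    rw [card_sdiff_of_subset (subset_univ _), hXUc]; simp
  obtain ⟨A, hZA, hA, hAc⟩ : ∃ A : Finset (Fin n),
      (X.biUnion fun x => U.biUnion fun u => link 𝒬 x u) \ (X ∪ U) ⊆ A ∧
        A ⊆ univ \ (X ∪ U) ∧ A.card = m := by
    refine exists_subsuperset_card_eq (sdiff_subset_sdiff (subset_univ _) subset_rfl) ?_ (by omega)
    refine (card_le_card sdiff_subset).trans (le_trans ?_ hm)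
    refine card_biUnion_le.trans (sum_le_sum fun x hx => card_biUnion_le.trans
      (sum_le_sum fun u hu => ?_))
    have hxu : x ≠ u := by rintro rfl; exact disjoint_left.1 hXU hx hu
    rw [codegree_eq_card_link h𝒬 hxu]
  have hAX : ∀ z ∈ A, z ∉ X ∧ z ∉ U := fun z hz => by simpa using hA hz
  -- The four kinds of balls: `A`, `X`, `U` and all the others, numbered 0, 1, 2, 3.
  let f : Fin n → Fin 4 := fun z => if z ∈ A then 0 else if z ∈ X then 1 else if z ∈ U then 2 else 3
  have hf0 : ∀ z, f z = 0 ↔ z ∈ A := fun z => by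
    simp only [f]; split_ifs <;> simp_all
  have hf1 : ∀ z, f z = 1 ↔ z ∈ X := fun z => by
    have := hAX z
    simp only [f]; split_ifs <;> simp_all
  have hf2 : ∀ z, f z = 2 ↔ z ∈ U := fun z => by
    have := hAX z
    have hXz : z ∈ X → z ∉ U := fun h => disjoint_left.1 hXU h
    simp only [f]; split_ifs <;> simp_all
  let col : Fin 3 → Fin 4 → Bool :=
    ![![true, true, true, false], ![true, true, false, false], ![true, false, true, false]]
  have htypes : ∀ s t u : Fin 4,
      ((∀ i, col i s = col i t ∨ col i s = col i u) ∨ (∀ i, col i t = col i s ∨ col i t = col i u) ∨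
        (∀ i, col i u = col i s ∨ col i u = col i t)) ∨
      (s = 1 ∨ t = 1 ∨ u = 1) ∧ (s = 2 ∨ t = 2 ∨ u = 2) ∧ (s = 3 ∨ t = 3 ∨ u = 3) := by
    decide
  have hbad : ∀ T ∈ 𝒬, ∀ x ∈ T, ∀ u ∈ T, ∀ z ∈ T, f x = 1 → f u = 2 → f z ≠ 3 := by
    intro T hT x hx u hu z hz hfx hfu hfz
    have hcard := card_of_isTripleQuerySet h𝒬 hT
    have hxu : x ≠ u := by rintro rfl; simp [hfx] at hfu
    have hxz : x ≠ z := by rintro rfl; simp [hfx] at hfz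
    have huz : u ≠ z := by rintro rfl; simp [hfu] at hfz
    have hTeq : {x, u, z} = T := by
      refine eq_of_subset_of_card_le ?_ ?_
      · intro w hw
        simp only [mem_insert, mem_singleton] at hw
        rcases hw with rfl | rfl | rfl <;> assumption
      · rw [hcard, card_eq_three.2 ⟨x, u, z, hxu, hxz, huz, rfl⟩]
    have hzA : z ∉ A := fun h => by rw [(hf0 z).2 h] at hfz; simp at hfz
    have hzX : z ∉ X := fun h => by rw [(hf1 z).2 h] at hfz; simp at hfz
    have hzU : z ∉ U := fun h => by rw [(hf2 z).2 h] at hfz; simp at hfz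
    refine hzA (hZA (mem_sdiff.2 ⟨?_, by simp [hzX, hzU]⟩))
    refine mem_biUnion.2 ⟨x, (hf1 x).1 hfx, mem_biUnion.2 ⟨u, (hf2 u).1 hfu, ?_⟩⟩
    simp [link, hxz.symm, huz.symm, hTeq, hT]
  refine not_determines_of_colourings h𝒬 (fun i z => col i (f z)) ?_ ?_
  · intro x y z _ _ _ hT
    rcases htypes (f x) (f y) (f z) with h | ⟨h1, h2, h3⟩
    · exact h
    · exfalso
      have e1 : ∃ w ∈ ({x, y, z} : Finset (Fin n)), f w = 1 := by simpa using h1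
      have e2 : ∃ w ∈ ({x, y, z} : Finset (Fin n)), f w = 2 := by simpa using h2
      have e3 : ∃ w ∈ ({x, y, z} : Finset (Fin n)), f w = 3 := by simpa using h3
      obtain ⟨a, ha, ha'⟩ := e1
      obtain ⟨b, hb, hb'⟩ := e2
      obtain ⟨d, hd, hd'⟩ := e3
      exact hbad _ hT a ha b hb d hd ha' hb' hd'
  · have h12 : ∀ W : Finset (Fin n), W.card = k → 2 * (A ∪ W).card < n := fun W hW => by
      have := card_union_le A W
      omega
    have hcol1 : ∀ a, col 1 (f a) = true → a ∈ A ∪ X := fun a h => by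
      have : ∀ s, col 1 s = true → s = 0 ∨ s = 1 := by decide
      rw [mem_union, ← hf0, ← hf1]; exact this _ h
    have hcol2 : ∀ a, col 2 (f a) = true → a ∈ A ∪ U := fun a h => by
      have : ∀ s, col 2 s = true → s = 0 ∨ s = 2 := by decide
      rw [mem_union, ← hf0, ← hf2]; exact this _ h
    have hcol0 : ∀ a, col 0 (f a) = false → a ∈ univ \ (A ∪ (X ∪ U)) := fun a h => by
      have : ∀ s, col 0 s = false → ¬ (s = 0 ∨ s = 1 ∨ s = 2) := by decide
      rw [mem_sdiff, mem_union, mem_union, ← hf0, ← hf1, ← hf2]; exact ⟨mem_univ _, this _ h⟩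
    have hC : 2 * (univ \ (A ∪ (X ∪ U))).card < n := by
      have hdisj : Disjoint A (X ∪ U) := disjoint_left.2 fun z hz => by
        have := hAX z hz
        simp [this]
      rw [card_sdiff_of_subset (subset_univ _), card_union_of_disjoint hdisj, hXUc, hAc, card_univ,
        Fintype.card_fin]
      omega
    intro b
    have hcases : ∀ s, col 1 s = true ∨ col 2 s = true ∨ col 0 s = false := by decide
    rcases hcases (f b) with h | h | h
    · refine ⟨1, lt_of_le_of_lt (Nat.mul_le_mul_left 2 (card_le_card ?_)) (h12 X hX)⟩
      intro a ha
      exact hcol1 a (by simpa [h] using ha)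
    · refine ⟨2, lt_of_le_of_lt (Nat.mul_le_mul_left 2 (card_le_card ?_)) (h12 U hU)⟩
      intro a ha
      exact hcol2 a (by simpa [h] using ha)
    · refine ⟨0, lt_of_le_of_lt (Nat.mul_le_mul_left 2 (card_le_card ?_)) hC⟩
      intro a ha
      exact hcol0 a (by simpa [h] using ha)

/-! ### Minimal covers by minority classes -/

/-- A family of strict minority classes of colourings, minimal among those that cover all balls,
stripped of the colourings it comes from. The last field records that these colourings are legal
for common answers: a ball that is the odd one out of a query in some colouring is not its answer,
so this cannot happen to all three balls of a query. -/
structure IsMinorityCover {n : ℕ} (𝒬 : Finset (Finset (Fin n))) (G : Finset (Finset (Fin n))) :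
    Prop where
  two_mul_card_lt : ∀ m ∈ G, 2 * m.card < n
  exists_mem : ∀ b, ∃ m ∈ G, b ∈ m
  exists_private : ∀ m ∈ G, ∃ p ∈ m, ∀ m' ∈ G, p ∈ m' → m' = m
  notMem_of_split : ∀ m₁ ∈ G, ∀ m₂ ∈ G, ∀ m₃ ∈ G, ∀ x y z, x ∈ m₁ → y ∉ m₁ → z ∉ m₁ →
    x ∉ m₂ → y ∈ m₂ → z ∉ m₂ → x ∉ m₃ → y ∉ m₃ → z ∈ m₃ → {x, y, z} ∉ 𝒬

theorem exists_minimal_cover {α : Type*} [DecidableEq α] (F : Finset (Finset α))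
    (hF : ∀ b, ∃ m ∈ F, b ∈ m) :
    ∃ G ⊆ F, (∀ b, ∃ m ∈ G, b ∈ m) ∧ ∀ m ∈ G, ∃ p ∈ m, ∀ m' ∈ G, p ∈ m' → m' = m := by
  classical
  obtain ⟨G, hG, hmin⟩ := exists_min_image
    (F.powerset.filter (fun G => ∀ b, ∃ m ∈ G, b ∈ m)) card ⟨F, by simpa using hF⟩
  simp only [mem_filter, mem_powerset] at hG hmin
  refine ⟨G, hG.1, hG.2, fun m hm => ?_⟩
  by_contra! h
  have := hmin (G.erase m) ⟨(erase_subset _ _).trans hG.1, fun b => by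
    obtain ⟨m', hm', hb⟩ := hG.2 b
    by_cases hmm : m' = m
    · obtain ⟨m'', h1, h2, h3⟩ := h b (hmm ▸ hb)
      exact ⟨m'', mem_erase.2 ⟨h3, h1⟩, h2⟩
    · exact ⟨m', mem_erase.2 ⟨hmm, hm'⟩, hb⟩⟩
  have := card_erase_lt_of_mem hm
  omega

theorem determines_of_forall_not_isMinorityCover {n : ℕ} {𝒬 : Finset (Finset (Fin n))}
    (h𝒬 : IsTripleQuerySet 𝒬) (h : ∀ G, ¬ IsMinorityCover 𝒬 G) : Determines 𝒬 := by
  intro ans _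
  by_contra! hno
  choose c hlegal hc using hno
  let F : Finset (Finset (Fin n)) :=
    univ.image fun b => univ.filter (fun a => c b a = c b b)
  have hF : ∀ m ∈ F, 2 * m.card < n ∧ ∃ b, ∀ a, a ∈ m ↔ c b a = c b b := by
    intro m hm
    obtain ⟨b, -, rfl⟩ := mem_image.1 hm
    refine ⟨?_, b, by simp⟩
    have hb := hc b
    simp only [IsNonMinorityBall, mem_univ, true_and, not_le, card_univ, Fintype.card_fin] at hb
    have : (2 : ℝ) * ((univ.filter (fun a => c b a = c b b)).card : ℝ) < n := by linarith
    exact_mod_cast this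
  obtain ⟨G, hGF, hcov, hpriv⟩ := exists_minimal_cover F
    fun b => ⟨_, mem_image_of_mem _ (mem_univ b), by simp⟩
  have hodd : ∀ m ∈ G, ∀ T : {T // T ∈ 𝒬}, ans T ∈ m → ∃ a ∈ T.1, a ≠ ans T ∧ a ∈ m := by
    intro m hm T hT
    obtain ⟨-, b, hb⟩ := hF m (hGF hm)
    obtain ⟨a, ha, hne, hca⟩ := (hlegal b T).exists_eq (card_of_isTripleQuerySet h𝒬 T.2)
    exact ⟨a, ha, hne, (hb a).2 (hca.trans ((hb _).1 hT))⟩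
  refine h G ⟨fun m hm => (hF m (hGF hm)).1, hcov, hpriv, ?_⟩
  intro m₁ h₁ m₂ h₂ m₃ h₃ x y z hx1 hy1 hz1 hx2 hy2 hz2 hx3 hy3 hz3 hT
  have hmem : ans ⟨_, hT⟩ ∈ ({x, y, z} : Finset (Fin n)) :=
    (hlegal (ans ⟨_, hT⟩) ⟨_, hT⟩).1
  have hall : ∀ m ∈ G, ans ⟨_, hT⟩ ∈ m → ∃ a ∈ ({x, y, z} : Finset (Fin n)),
    a ≠ ans ⟨_, hT⟩ ∧ a ∈ m := fun m hm => hodd m hm ⟨_, hT⟩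
  generalize ans ⟨_, hT⟩ = t at hmem hall
  simp only [mem_insert, mem_singleton] at hmem hall
  rcases hmem with rfl | rfl | rfl
  · obtain ⟨a, ha | ha | ha, hne, ham⟩ := hall m₁ h₁ hx1 <;> simp_all
  · obtain ⟨a, ha | ha | ha, hne, ham⟩ := hall m₂ h₂ hy2 <;> simp_all
  · obtain ⟨a, ha | ha | ha, hne, ham⟩ := hall m₃ h₃ hz3 <;> simp_all

namespace IsMinorityCover

variable {n : ℕ} {𝒬 G : Finset (Finset (Fin n))}

theorem two_lt_card (hn : 0 < n) (hG : IsMinorityCover 𝒬 G) : 2 < G.card := by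
  by_contra! hle
  have h1 : n ≤ ∑ m ∈ G, m.card := by
    have hcov : (univ : Finset (Fin n)) ⊆ G.biUnion id := fun b _ => by
      simpa using hG.exists_mem b
    simpa using (card_le_card hcov).trans card_biUnion_le
  have h2 : ∑ m ∈ G, 2 * m.card ≤ ∑ _m ∈ G, (n - 1) := sum_le_sum fun m hm => by
    have := hG.two_mul_card_lt m hm
    omega
  rw [← mul_sum, sum_const, smul_eq_mul] at h2
  have h3 := Nat.mul_le_mul_right (n - 1) hle
  omega

/-- For private balls `p₁`, `p₂` of two classes, every ball `z` outside these classes lies in a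
third one, which splits `z` off `{p₁, p₂, z}`; so this triple is not a query. -/
theorem codegree_add_card_compl_le (h𝒬 : IsTripleQuerySet 𝒬) (hG : IsMinorityCover 𝒬 G)
    {m₁ m₂ : Finset (Fin n)} (h₁ : m₁ ∈ G) (h₂ : m₂ ∈ G) (hne : m₁ ≠ m₂) {p₁ p₂ : Fin n}
    (hp₁ : p₁ ∈ m₁) (hp₁' : ∀ m ∈ G, p₁ ∈ m → m = m₁)
    (hp₂ : p₂ ∈ m₂) (hp₂' : ∀ m ∈ G, p₂ ∈ m → m = m₂) :
    codegree 𝒬 p₁ p₂ + (m₁ ∪ m₂)ᶜ.card + 2 ≤ n := by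
  have h12 : p₁ ∉ m₂ := fun h => hne (hp₁' _ h₂ h).symm
  have h21 : p₂ ∉ m₁ := fun h => hne (hp₂' _ h₁ h)
  have hpp : p₁ ≠ p₂ := fun h => h12 (h ▸ hp₂)
  have hle : (m₁ ∪ m₂)ᶜ.card ≤
      (univ.filter (fun z => z ≠ p₁ ∧ z ≠ p₂ ∧ {p₁, p₂, z} ∉ 𝒬)).card := by
    refine card_le_card fun z hz => ?_
    simp only [mem_compl, mem_union, not_or] at hz
    obtain ⟨m₃, h₃, hz3⟩ := hG.exists_mem z
    simp only [mem_filter, mem_univ, true_and]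
    refine ⟨fun h => hz.1 (h ▸ hp₁), fun h => hz.2 (h ▸ hp₂), ?_⟩
    refine hG.notMem_of_split m₁ h₁ m₂ h₂ m₃ h₃ p₁ p₂ z hp₁ h21 hz.1 h12 hp₂ hz.2 ?_ ?_ hz3
    · exact fun h => hz.1 (hp₁' _ h₃ h ▸ hz3)
    · exact fun h => hz.2 (hp₂' _ h₃ h ▸ hz3)
  have := codegree_add_card_compl h𝒬 hpp
  omega

theorem privates_notMem (hG : IsMinorityCover 𝒬 G) {m₁ m₂ m₃ : Finset (Fin n)} (h₁ : m₁ ∈ G)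
    (h₂ : m₂ ∈ G) (h₃ : m₃ ∈ G) (h12 : m₁ ≠ m₂) (h13 : m₁ ≠ m₃) (h23 : m₂ ≠ m₃) {p₁ p₂ p₃ : Fin n}
    (hp₁ : p₁ ∈ m₁) (hp₁' : ∀ m ∈ G, p₁ ∈ m → m = m₁)
    (hp₂ : p₂ ∈ m₂) (hp₂' : ∀ m ∈ G, p₂ ∈ m → m = m₂)
    (hp₃ : p₃ ∈ m₃) (hp₃' : ∀ m ∈ G, p₃ ∈ m → m = m₃) :
    {p₁, p₂, p₃} ∉ 𝒬 :=
  hG.notMem_of_split m₁ h₁ m₂ h₂ m₃ h₃ p₁ p₂ p₃ hp₁ (fun h => h12 (hp₂' _ h₁ h))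
    (fun h => h13 (hp₃' _ h₁ h)) (fun h => h12 (hp₁' _ h₂ h).symm) hp₂
    (fun h => h23 (hp₃' _ h₂ h)) (fun h => h13 (hp₁' _ h₃ h).symm)
    (fun h => h23 (hp₂' _ h₃ h).symm) hp₃

end IsMinorityCover

/-- Of three classes of a cover, two have a common complement of more than `n / 6` balls: the
complements have more than `n / 2` balls each, and the Bonferroni inequality applies. -/
theorem determines_of_lt_minCodegree {n : ℕ} {𝒬 : Finset (Finset (Fin n))}
    (h𝒬 : IsTripleQuerySet 𝒬) (hn : 0 < n) (hδ : 5 * n < 6 * minCodegree 𝒬) : Determines 𝒬 := by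
  refine determines_of_forall_not_isMinorityCover h𝒬 fun G hG => ?_
  obtain ⟨m₁, m₂, m₃, h₁, h₂, h₃, h12, h13, h23⟩ := two_lt_card_iff.1 (hG.two_lt_card hn)
  have hpair : ∀ m ∈ G, ∀ m' ∈ G, m ≠ m' → 6 * (mᶜ ∩ m'ᶜ).card < n := by
    intro m hm m' hm' hne
    obtain ⟨p, hp, hpm⟩ := hG.exists_private m hm
    obtain ⟨q, hq, hqm⟩ := hG.exists_private m' hm'
    have hle := hG.codegree_add_card_compl_le h𝒬 hm hm' hne hp hpm hq hqm
    have hpq : p ≠ q := fun h => hne (hqm _ hm (h ▸ hp))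
    have := minCodegree_le 𝒬 hpq
    rw [compl_union] at hle
    omega
  have hbig : ∀ m ∈ G, n < 2 * mᶜ.card := fun m hm => by
    have := hG.two_mul_card_lt m hm
    rw [card_compl, Fintype.card_fin]
    omega
  have := hpair _ h₁ _ h₂ h12
  have := hpair _ h₁ _ h₃ h13
  have := hpair _ h₂ _ h₃ h23
  have := hbig _ h₁
  have := hbig _ h₂
  have := hbig _ h₃
  have := card_union_add_card_inter m₁ᶜ m₂ᶜ
  have := card_union_add_card_inter (m₁ᶜ ∪ m₂ᶜ) m₃ᶜ
  have h := card_union_le (m₁ᶜ ∩ m₃ᶜ) (m₂ᶜ ∩ m₃ᶜ)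
  rw [← union_inter_distrib_right] at h
  have : (m₁ᶜ ∪ m₂ᶜ ∪ m₃ᶜ).card ≤ n := by simpa using card_le_univ (m₁ᶜ ∪ m₂ᶜ ∪ m₃ᶜ)
  omega

/-! ### Query sets with a single sparse pair -/

/-- If only queries containing both `x` and `y` are missing, then the private balls of any three
classes of a minority cover include `x` and `y`. So there are exactly three classes, with `x` and
`y` the only private balls of two of them, `m₁` and `m₂`. All balls but `x` and `y` lie in the third
class or in `m₁ ∩ m₂`, so `m₁ ∪ m₂` is too small for the co-degree of `x` and `y`. -/
theorem determines_of_sparse_pair {n : ℕ} {𝒬 : Finset (Finset (Fin n))} (h𝒬 : IsTripleQuerySet 𝒬)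
    {x y : Fin n} (hxy : x ≠ y) (hall : ∀ T : Finset (Fin n), T.card = 3 → T ∉ 𝒬 → x ∈ T ∧ y ∈ T)
    (hd : n / 2 + 1 ≤ codegree 𝒬 x y) : Determines 𝒬 := by
  refine determines_of_forall_not_isMinorityCover h𝒬 fun G hG => ?_
  have htriple : ∀ m₁ ∈ G, ∀ m₂ ∈ G, ∀ m₃ ∈ G, m₁ ≠ m₂ → m₁ ≠ m₃ → m₂ ≠ m₃ → ∀ p₁ p₂ p₃,
      (p₁ ∈ m₁ ∧ ∀ m ∈ G, p₁ ∈ m → m = m₁) → (p₂ ∈ m₂ ∧ ∀ m ∈ G, p₂ ∈ m → m = m₂) →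
      (p₃ ∈ m₃ ∧ ∀ m ∈ G, p₃ ∈ m → m = m₃) →
      (x = p₁ ∨ x = p₂ ∨ x = p₃) ∧ (y = p₁ ∨ y = p₂ ∨ y = p₃) := by
    intro m₁ h₁ m₂ h₂ m₃ h₃ h12 h13 h23 p₁ p₂ p₃ hp₁ hp₂ hp₃
    have hc : ({p₁, p₂, p₃} : Finset (Fin n)).card = 3 := card_eq_three.2 ⟨p₁, p₂, p₃,
      fun h => h12 (hp₂.2 _ h₁ (h ▸ hp₁.1)), fun h => h13 (hp₃.2 _ h₁ (h ▸ hp₁.1)),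
      fun h => h23 (hp₃.2 _ h₂ (h ▸ hp₂.1)), rfl⟩
    simpa using hall _ hc
      (hG.privates_notMem h₁ h₂ h₃ h12 h13 h23 hp₁.1 hp₁.2 hp₂.1 hp₂.2 hp₃.1 hp₃.2)
  obtain ⟨m₁, h₁, m₂, h₂, m₃, h₃, h12, h13, h23, hx, hy⟩ : ∃ m₁ ∈ G, ∃ m₂ ∈ G, ∃ m₃ ∈ G,
      m₁ ≠ m₂ ∧ m₁ ≠ m₃ ∧ m₂ ≠ m₃ ∧ (x ∈ m₁ ∧ ∀ m ∈ G, x ∈ m → m = m₁) ∧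
        (y ∈ m₂ ∧ ∀ m ∈ G, y ∈ m → m = m₂) := by
    obtain ⟨m₁, m₂, m₃, h₁, h₂, h₃, h12, h13, h23⟩ := two_lt_card_iff.1 (hG.two_lt_card x.pos)
    obtain ⟨p₁, hp₁⟩ := hG.exists_private m₁ h₁
    obtain ⟨p₂, hp₂⟩ := hG.exists_private m₂ h₂
    obtain ⟨p₃, hp₃⟩ := hG.exists_private m₃ h₃
    obtain ⟨rfl | rfl | rfl, rfl | rfl | rfl⟩ :=
      htriple _ h₁ _ h₂ _ h₃ h12 h13 h23 _ _ _ hp₁ hp₂ hp₃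
    · exact absurd rfl hxy
    · exact ⟨m₁, h₁, m₂, h₂, m₃, h₃, h12, h13, h23, hp₁, hp₂⟩
    · exact ⟨m₁, h₁, m₃, h₃, m₂, h₂, h13, h12, h23.symm, hp₁, hp₃⟩
    · exact ⟨m₂, h₂, m₁, h₁, m₃, h₃, h12.symm, h23, h13, hp₂, hp₁⟩
    · exact absurd rfl hxy
    · exact ⟨m₂, h₂, m₃, h₃, m₁, h₁, h23, h12.symm, h13.symm, hp₂, hp₃⟩
    · exact ⟨m₃, h₃, m₁, h₁, m₂, h₂, h13.symm, h23.symm, h12, hp₃, hp₁⟩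
    · exact ⟨m₃, h₃, m₂, h₂, m₁, h₁, h23.symm, h13.symm, h12.symm, hp₃, hp₂⟩
    · exact absurd rfl hxy
  obtain ⟨q, hq⟩ := hG.exists_private m₃ h₃
  have hqx : q ≠ x := fun h => h13.symm (hx.2 _ h₃ (h ▸ hq.1))
  have hqy : q ≠ y := fun h => h23.symm (hy.2 _ h₃ (h ▸ hq.1))
  have honly : ∀ m ∈ G, m = m₁ ∨ m = m₂ ∨ m = m₃ := by
    intro m hm
    by_contra! hne
    obtain ⟨p, hp⟩ := hG.exists_private m hm
    rcases (htriple _ h₁ _ h₃ _ hm h13 hne.1.symm hne.2.2.symm _ _ _ hx hq hp).2 with h | h | h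
    · exact hxy h.symm
    · exact hqy h.symm
    · exact hne.2.1 (hy.2 _ hm (h ▸ hp.1))
  have hpriv₁ : ∀ a, a ∈ m₁ → a ∉ m₂ → a ∉ m₃ → a = x := by
    intro a ha ha2 ha3
    have haG : ∀ m ∈ G, a ∈ m → m = m₁ := fun m hm ham => by
      rcases honly m hm with rfl | rfl | rfl
      · rfl
      · exact absurd ham ha2
      · exact absurd ham ha3
    rcases (htriple _ h₁ _ h₂ _ h₃ h12 h13 h23 _ _ _ ⟨ha, haG⟩ hy hq).1 with h | h | h
    · exact h.symm
    · exact absurd h hxy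
    · exact absurd h.symm hqx
  have hpriv₂ : ∀ a, a ∈ m₂ → a ∉ m₁ → a ∉ m₃ → a = y := by
    intro a ha ha1 ha3
    have haG : ∀ m ∈ G, a ∈ m → m = m₂ := fun m hm ham => by
      rcases honly m hm with rfl | rfl | rfl
      · exact absurd ham ha1
      · rfl
      · exact absurd ham ha3
    rcases (htriple _ h₁ _ h₂ _ h₃ h12 h13 h23 _ _ _ hx ⟨ha, haG⟩ hq).2 with h | h | h
    · exact absurd h.symm hxy
    · exact h.symm
    · exact absurd h.symm hqy
  have hcov : (univ : Finset (Fin n)) ⊆ ({x, y} ∪ m₃) ∪ (m₁ ∩ m₂) := by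
    intro a _
    simp only [mem_union, mem_inter, mem_insert, mem_singleton]
    obtain ⟨m, hm, ham⟩ := hG.exists_mem a
    have := hpriv₁ a
    have := hpriv₂ a
    rcases honly m hm with rfl | rfl | rfl <;> tauto
  have hn := card_le_card hcov
  rw [card_univ, Fintype.card_fin] at hn
  have := card_union_le ({x, y} ∪ m₃) (m₁ ∩ m₂)
  have := card_union_le {x, y} m₃
  have := card_pair hxy
  have := card_union_add_card_inter m₁ m₂
  have := hG.two_mul_card_lt _ h₁
  have := hG.two_mul_card_lt _ h₂
  have := hG.two_mul_card_lt _ h₃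
  have hle := hG.codegree_add_card_compl_le h𝒬 h₁ h₂ h12 hx.1 hx.2 hy.1 hy.2
  rw [card_compl, Fintype.card_fin] at hle
  omega

theorem exists_determines_minCodegree_eq {n : ℕ} (hn : 5 ≤ n) :
    ∃ 𝒬 : Finset (Finset (Fin n)), IsTripleQuerySet 𝒬 ∧ minCodegree 𝒬 = n / 2 + 1 ∧
      Determines 𝒬 := by
  have hxy : (⟨0, by omega⟩ : Fin n) ≠ ⟨1, by omega⟩ := by simp
  generalize (⟨0, by omega⟩ : Fin n) = x at hxy
  generalize (⟨1, by omega⟩ : Fin n) = y at hxy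
  have hn2 : 2 ≤ n := by omega
  obtain ⟨𝒬, h0, h1, hδ⟩ := exists_minCodegree_eq hn2
    (filter_subset (fun T => ¬ (x ∈ T ∧ y ∈ T)) (powersetCard 3 (univ : Finset (Fin n))))
    (t := n / 2 + 1)
    (by
      refine (minCodegree_le _ hxy).trans ?_
      rw [codegree, filter_filter, filter_eq_empty_iff.2 (fun T _ => by tauto)]
      simp)
    (by
      obtain ⟨a, b, hab, h⟩ :=
        exists_codegree_eq_minCodegree hn2 (powersetCard 3 (univ : Finset (Fin n)))
      rw [← h]
      have hc := codegree_add_card_compl (𝒬 := powersetCard 3 (univ : Finset (Fin n))) subset_rfl hab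
      rw [filter_eq_empty_iff.2, card_empty] at hc
      · omega
      · rintro z - ⟨hza, hzb, hz⟩
        exact hz (mem_powersetCard.2
          ⟨subset_univ _, card_eq_three.2 ⟨a, b, z, hab, hza.symm, hzb.symm, rfl⟩⟩))
  refine ⟨𝒬, h1, hδ, determines_of_sparse_pair h1 hxy (fun T hT hT𝒬 => ?_)
    (hδ ▸ minCodegree_le 𝒬 hxy)⟩
  by_contra h
  exact hT𝒬 (h0 (mem_filter.2 ⟨mem_powersetCard.2 ⟨subset_univ _, hT⟩, h⟩))

/-! ### Query sets of large co-degree that do not determine -/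

theorem exists_fiber_card_eq {ι : Type*} [Fintype ι] [DecidableEq ι] {n : ℕ} (s : ι → ℕ)
    (hs : ∑ i, s i = n) : ∃ f : Fin n → ι, ∀ i, (univ.filter (fun a => f a = i)).card = s i := by
  have e : Fin n ≃ Σ i, Fin (s i) := Fintype.equivOfCardEq (by simp [hs])
  refine ⟨fun a => (e a).1, fun i => ?_⟩
  have : (univ.filter (fun a => (e a).1 = i)).card =
      (univ.filter (fun a : Σ i, Fin (s i) => a.1 = i)).card := by
    refine card_bij (fun a _ => e a) (by simp) (fun a _ b _ h => e.injective h) fun b hb => ?_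
    exact ⟨e.symm b, by simpa using hb, by simp⟩
  rw [this, ← Fintype.card_subtype, Fintype.card_congr (Equiv.sigmaSubtype i), Fintype.card_fin]

/-- The colour that balls of type `p` get in the `i`-th of three colourings. Balls of type
`(i, false)` differ in colouring `i` from those of the types `(j, false)` with `j ≠ i`, so three balls
of distinct types `(j, false)` are split, and likewise with `true`; no other triple is split. -/
def typeColour (i : Fin 3) (p : Fin 3 × Bool) : Bool := xor (decide (p.1 = i)) p.2

/-- Balls are distributed over six types. A pair of balls lies in split triples with balls of at
most one type, so `M ≥ s p` bounds the number of triples at a pair that have to be left out. -/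
theorem exists_not_determines {n t : ℕ} (hn : 2 ≤ n) (s : Fin 3 × Bool → ℕ) (hs : ∑ p, s p = n)
    (hM : ∀ p, s p + t + 2 ≤ n)
    (hmin : ∀ i, 2 * ∑ p with typeColour i p = true, s p < n) :
    ∃ 𝒬 : Finset (Finset (Fin n)), IsTripleQuerySet 𝒬 ∧ minCodegree 𝒬 = t ∧ ¬ Determines 𝒬 := by
  classical
  obtain ⟨f, hf⟩ := exists_fiber_card_eq s hs
  let 𝒬₁ : Finset (Finset (Fin n)) := (powersetCard 3 univ).filter
    (fun T => ¬ ∃ b, ∀ j : Fin 3, ∃ x ∈ T, f x = (j, b))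
  have h𝒬₁ : IsTripleQuerySet 𝒬₁ := filter_subset _ _
  obtain ⟨𝒬, -, hsub, hδ⟩ := exists_minCodegree_eq hn (empty_subset 𝒬₁) (t := t)
    (by
      refine (minCodegree_le _ (x := ⟨0, by omega⟩) (y := ⟨1, by omega⟩) (by simp)).trans ?_
      simp [codegree])
    (by
      obtain ⟨x, y, hxy, h⟩ := exists_codegree_eq_minCodegree hn 𝒬₁
      rw [← h]
      have hc := codegree_add_card_compl h𝒬₁ hxy
      have htype : ∀ p q : Fin 3 × Bool, ∃ r, ∀ r',
          (∃ b, ∀ j : Fin 3, p = (j, b) ∨ q = (j, b) ∨ r' = (j, b)) → r' = r := by decide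
      obtain ⟨r, hr⟩ := htype (f x) (f y)
      have hle : (univ.filter (fun z => z ≠ x ∧ z ≠ y ∧ {x, y, z} ∉ 𝒬₁)).card ≤ s r := by
        rw [← hf r]
        refine card_le_card fun z hz => ?_
        simp only [mem_filter, mem_univ, true_and] at hz ⊢
        obtain ⟨hzx, hzy, hz⟩ := hz
        refine hr _ ?_
        by_contra hno
        refine hz (mem_filter.2 ⟨mem_powersetCard.2 ⟨subset_univ _,
          card_eq_three.2 ⟨x, y, z, hxy, hzx.symm, hzy.symm, rfl⟩⟩, ?_⟩)
        simpa using hno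
      have := hM r
      omega)
  refine ⟨𝒬, hsub.trans h𝒬₁, hδ, ?_⟩
  refine not_determines_of_colourings (hsub.trans h𝒬₁) (fun i z => typeColour i (f z)) ?_ ?_
  · intro x y z _ _ _ hT
    have htypes : ∀ p q r : Fin 3 × Bool,
        ¬ (∃ b, ∀ j : Fin 3, p = (j, b) ∨ q = (j, b) ∨ r = (j, b)) →
        (∀ i, typeColour i p = typeColour i q ∨ typeColour i p = typeColour i r) ∨
        (∀ i, typeColour i q = typeColour i p ∨ typeColour i q = typeColour i r) ∨
        (∀ i, typeColour i r = typeColour i p ∨ typeColour i r = typeColour i q) := by decide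
    refine htypes _ _ _ ?_
    simpa using (mem_filter.1 (hsub hT)).2
  · intro b
    have hex : ∀ p, ∃ i, typeColour i p = true := by decide
    obtain ⟨i, hi⟩ := hex (f b)
    refine ⟨i, lt_of_eq_of_lt (congrArg (2 * ·) ?_) (hmin i)⟩
    rw [card_eq_sum_card_fiberwise (f := f) (t := univ.filter (fun p => typeColour i p = true))]
    · refine sum_congr rfl fun p hp => ?_
      rw [← hf p, filter_filter]
      congr 1
      ext a
      simp only [mem_filter, mem_univ, true_and] at hp ⊢
      constructor
      · exact fun h => h.2
      · rintro rfl
        exact ⟨hp.trans hi.symm, rfl⟩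
    · intro a ha
      simpa [hi] using ha

/-- Type sizes for `exists_not_determines`, close to `n / 6`; the types `(i, false)` get slightly
more balls than the types `(i, true)`, which lie in two of the three minority classes. -/
theorem exists_type_sizes {n : ℕ} (hn : 5 ≤ n) : ∃ s : Fin 3 × Bool → ℕ, ∑ p, s p = n ∧
    (∀ p, s p + (5 * n / 6 - 3) + 2 ≤ n) ∧
    ∀ i, 2 * ∑ p with typeColour i p = true, s p < n := by
  have key : ∃ q₀ q₁ q₂ r₀ r₁ r₂ : ℕ, q₀ + q₁ + q₂ + r₀ + r₁ + r₂ = n ∧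
      (q₀ + (5 * n / 6 - 3) + 2 ≤ n ∧ q₁ + (5 * n / 6 - 3) + 2 ≤ n ∧
        q₂ + (5 * n / 6 - 3) + 2 ≤ n) ∧
      (r₀ + (5 * n / 6 - 3) + 2 ≤ n ∧ r₁ + (5 * n / 6 - 3) + 2 ≤ n ∧
        r₂ + (5 * n / 6 - 3) + 2 ≤ n) ∧
      2 * (q₀ + r₁ + r₂) < n ∧ 2 * (q₁ + r₀ + r₂) < n ∧ 2 * (q₂ + r₀ + r₁) < n := by
    obtain ⟨k, r, hr, rfl⟩ : ∃ k r, r < 6 ∧ n = 6 * k + r :=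
      ⟨n / 6, n % 6, Nat.mod_lt _ (by norm_num), by omega⟩
    interval_cases r
    · exact ⟨k + 1, k + 1, k + 1, k - 1, k - 1, k - 1, by omega⟩
    · exact ⟨k + 1, k + 1, k, k, k, k - 1, by omega⟩
    · exact ⟨k + 2, k + 1, k + 1, k, k - 1, k - 1, by omega⟩
    · exact ⟨k + 1, k + 1, k + 1, k, k, k, by omega⟩
    · exact ⟨k + 2, k + 2, k + 1, k, k, k - 1, by omega⟩
    · exact ⟨k + 2, k + 1, k + 1, k + 1, k, k, by omega⟩
  obtain ⟨q₀, q₁, q₂, r₀, r₁, r₂, hsum, ⟨hq₀, hq₁, hq₂⟩, ⟨hr₀, hr₁, hr₂⟩, h₀, h₁, h₂⟩ := key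
  refine ⟨fun p => if p.2 then ![r₀, r₁, r₂] p.1 else ![q₀, q₁, q₂] p.1, ?_, ?_, ?_⟩
  · simp [Fintype.sum_prod_type, Fin.sum_univ_three]
    omega
  · rintro ⟨i, b⟩
    fin_cases i <;> cases b <;> simpa
  · intro i
    rw [sum_filter, Fintype.sum_prod_type, Fin.sum_univ_three]
    simp only [Fintype.sum_bool]
    fin_cases i <;> simp [typeColour] <;> omega

theorem exists_not_determines_minCodegree_eq {n : ℕ} (hn : 4 ≤ n) :
    ∃ 𝒬 : Finset (Finset (Fin n)), IsTripleQuerySet 𝒬 ∧ minCodegree 𝒬 = 5 * n / 6 - 3 ∧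
      ¬ Determines 𝒬 := by
  obtain rfl | hn5 : n = 4 ∨ 5 ≤ n := by omega
  · -- Here the co-degree is zero. Without queries, one ball may differ from the three others.
    refine ⟨∅, empty_subset _, Nat.le_zero.1 ?_, ?_⟩
    · exact (minCodegree_le ∅ (x := (0 : Fin 4)) (y := 1) (by simp)).trans (by simp [codegree])
    · refine not_determines_of_colourings (empty_subset _) (fun b a => decide (a = b)) (by simp) ?_
      exact fun b => ⟨b, by simp [filter_eq']⟩
  · obtain ⟨s, hs, hM, hmin⟩ := exists_type_sizes hn5
    exact exists_not_determines (by omega) s hs hM hmin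

end MajorityBalls

theorem theorem3 :
    -- (i)
    (∀ (n : ℕ) (𝒬 : Finset (Finset (Fin n))), Odd n → MajorityBalls.IsTripleQuerySet 𝒬 →
      (∃ x y : Fin n, x ≠ y ∧
        (MajorityBalls.codegree 𝒬 x y : ℝ) < ((n : ℝ) - 2) / 2) →
      ¬ MajorityBalls.Determines 𝒬) ∧
    -- (ii)
    (∀ n : ℕ, 5 ≤ n → ∃ 𝒬 : Finset (Finset (Fin n)), MajorityBalls.IsTripleQuerySet 𝒬 ∧
      MajorityBalls.minCodegree 𝒬 = n / 2 + 1 ∧ MajorityBalls.Determines 𝒬) ∧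
    -- (iii)
    (∀ (n : ℕ) (𝒬 : Finset (Finset (Fin n))), Even n → MajorityBalls.IsTripleQuerySet 𝒬 →
      (∃ x y u v : Fin n, x ≠ y ∧ x ≠ u ∧ x ≠ v ∧ y ≠ u ∧ y ≠ v ∧ u ≠ v ∧
        (MajorityBalls.codegree 𝒬 x u : ℝ) + (MajorityBalls.codegree 𝒬 x v : ℝ)
          + (MajorityBalls.codegree 𝒬 y u : ℝ) + (MajorityBalls.codegree 𝒬 y v : ℝ)
          ≤ (n : ℝ) / 2 - 3) →
      ¬ MajorityBalls.Determines 𝒬) ∧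
    -- (iv)
    (∀ (n : ℕ) (𝒬 : Finset (Finset (Fin n))), MajorityBalls.IsTripleQuerySet 𝒬 →
      5 * (n : ℝ) / 6 < (MajorityBalls.minCodegree 𝒬 : ℝ) → MajorityBalls.Determines 𝒬) ∧
    -- (v)
    (∀ n : ℕ, 4 ≤ n → ∃ 𝒬 : Finset (Finset (Fin n)), MajorityBalls.IsTripleQuerySet 𝒬 ∧
      (MajorityBalls.minCodegree 𝒬 : ℤ) = ⌊5 * (n : ℝ) / 6⌋ - 3 ∧
      ¬ MajorityBalls.Determines 𝒬) := by
  refine ⟨?_, fun n hn => MajorityBalls.exists_determines_minCodegree_eq hn, ?_, ?_, ?_⟩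
  · rintro n 𝒬 ⟨j, rfl⟩ h𝒬 ⟨x, y, hxy, hd⟩
    have hd' : MajorityBalls.codegree 𝒬 x y + 1 ≤ j := by
      have : (2 : ℝ) * MajorityBalls.codegree 𝒬 x y + 1 < 2 * j := by push_cast at hd; linarith
      have : 2 * MajorityBalls.codegree 𝒬 x y + 1 < 2 * j := by exact_mod_cast this
      omega
    exact MajorityBalls.not_determines_of_sum_codegree_le h𝒬 (X := {x}) (U := {y}) (k := 1)
      (m := j - 1) (by simpa using hxy) (by simp) (by simp) (by simp; omega) (by omega) (by omega)
  · rintro n 𝒬 ⟨j, rfl⟩ h𝒬 ⟨x, y, u, v, hxy, hxu, hxv, hyu, hyv, huv, hd⟩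
    have hd' : MajorityBalls.codegree 𝒬 x u + MajorityBalls.codegree 𝒬 x v +
        MajorityBalls.codegree 𝒬 y u + MajorityBalls.codegree 𝒬 y v + 3 ≤ j := by
      have : (MajorityBalls.codegree 𝒬 x u : ℝ) + MajorityBalls.codegree 𝒬 x v +
          MajorityBalls.codegree 𝒬 y u + MajorityBalls.codegree 𝒬 y v + 3 ≤ j := by
        push_cast at hd; linarith
      exact_mod_cast this
    refine MajorityBalls.not_determines_of_sum_codegree_le h𝒬 (X := {x, y}) (U := {u, v})
      (k := 2) (m := j - 3) ?_ (Finset.card_pair hxy) (Finset.card_pair huv) ?_ (by omega) (by omega)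
    · simp [hxu.symm, hxv.symm, hyu.symm, hyv.symm]
    · rw [Finset.sum_pair hxy, Finset.sum_pair huv, Finset.sum_pair huv]
      omega
  · intro n 𝒬 h𝒬 hδ
    have hδ' : 5 * n < 6 * MajorityBalls.minCodegree 𝒬 := by
      have : (5 : ℝ) * n < 6 * MajorityBalls.minCodegree 𝒬 := by linarith
      exact_mod_cast this
    refine MajorityBalls.determines_of_lt_minCodegree h𝒬 (Nat.pos_of_ne_zero ?_) hδ'
    -- Without balls the minimum co-degree is the infimum of the empty set, which is zero.
    rintro rfl
    have : MajorityBalls.minCodegree 𝒬 = 0 := by simp [MajorityBalls.minCodegree]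
    omega
  · intro n hn
    obtain ⟨𝒬, h𝒬, hδ, hdet⟩ := MajorityBalls.exists_not_determines_minCodegree_eq hn
    refine ⟨𝒬, h𝒬, ?_, hdet⟩
    have hfloor : ⌊5 * (n : ℝ) / 6⌋ = ((5 * n / 6 : ℕ) : ℤ) := by
      rw [Int.floor_eq_iff]
      have h1 : 6 * (5 * n / 6) ≤ 5 * n := by omega
      have h2 : 5 * n < 6 * (5 * n / 6) + 6 := by omega
      have h1' : (6 : ℝ) * ((5 * n / 6 : ℕ) : ℝ) ≤ 5 * n := by exact_mod_cast h1
      have h2' : (5 : ℝ) * n < 6 * ((5 * n / 6 : ℕ) : ℝ) + 6 := by exact_mod_cast h2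
      rw [Int.cast_natCast]
      constructor <;> linarith
    rw [hδ, hfloor]
    omega
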